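/- Let $(\Omega,\mathcal F)$ be a measurable space and $\mathfrak P$ a nonempty set of probability measures on $\mathcal F$. Conventions: - For a nonempty set $\mathfrak R$ of probability measures on a σ-algebra $\mathcal A$, an event $N\in\mathcal A$ is $\mathfrak R$-polar if $\sup_{R\in\mathfrak R}R(N)=0$, and a property holds $\mathfrak R$-quasi surely if it holds outside an $\mathfrak R$-polar event. $L^\infty(\mathcal A,\mathfrak R)$ is the vector lattice of $\mathfrak R$-quasi surely bounded $\mathcal A$-measurable functions $f:\Omega\to\mathbb R$ modulo $\mathfrak R$-quasi-sure equality, with the quasi-sure order. - A set $\mathfrak T$ of measures dominates a set $\mathfrak S$ of measures on the same σ-algebra if every event that is null for all members of $\mathfrak T$ is null for all members of $\mathfrak S$; $\mathfrak S\approx\mathfrak T$ means domination in both directions. - A measure $\mu$ on $\mathcal A$ is supported (with respect to $\mathfrak R$) if there is $S\in\mathcal A$ with $\mu(S^c)=0$ such that, for all $N\in\mathcal A$, $\mu(N\cap S)=0$ implies that $N\cap S$ is $\mathfrak R$-polar. $sca(\mathcal A,\mathfrak R)$ is the set of finite signed measures $\mu$ on $\mathcal A$ whose total variation $|\mu|$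 is dominated by $\mathfrak R$ and supported. - A supported alternative to $\mathfrak R$ is a nonempty set $\mathfrak Q\approx\mathfrak R$ of supported probability measures; $\mathfrak R$ is of class (S) if a supported alternative exists. - For a set $\mathfrak S$ of measures on $\mathcal A$, $\mathcal A(\mathfrak S)=\bigcap_{\mu\in\mathfrak S}\sigma(\mathcal A\cup\mathfrak n(\mu))$, where $\mathfrak n(\mu)$ is the collection of subsets of $\mu$-null events of $\mathcal A$. For $\mu\in\mathfrak S$, $\mu^\sharp$ is the unique extension of $\mu$ to $\mathcal A(\mathfrak S)$, and $\mathfrak S^\sharp=\{\mu^\sharp\mid\mu\in\mathfrak S\}$. - An enlargement of $(\mathcal A,\mathfrak R)$ is a pair $(\mathcal B,\mathfrak R')$ of a σ-algebra $\mathcal B\supset\mathcal A$ on $\Omega$ and a nonempty set $\mathfrak R'$ of probability measures on $\mathcal B$ such that $\{R'|_{\mathcal A}\mid R'\in\mathfrak R'\}\approx\mathfrak R$. Its canonical map $J:L^\infty(\mathcal A,\mathfrak R)\to L^\infty(\mathcal B,\mathfrak R')$ sends the class of $f$ to the class of $f$. The enlargement completes $L^\infty(\mathcal A,\mathfrak R)$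 if $L^\infty(\mathcal B,\mathfrak R')$ is Dedekind complete and the range of $J$ is order dense and majorising in it, i.e. if $J$ exhibits $L^\infty(\mathcal B,\mathfrak R')$ as the Dedekind completion of $L^\infty(\mathcal A,\mathfrak R)$. **Theorem.** Suppose that $\mathfrak P$ is of class (S) and that an enlargement $(\mathcal G,\widehat{\mathfrak P})$ of $(\mathcal F,\mathfrak P)$ completes $L^\infty(\mathcal F,\mathfrak P)$. Then: 1. Each $\mu\in sca(\mathcal F,\mathfrak P)$ has a unique extension $\widehat\mu\in sca(\mathcal G,\widehat{\mathfrak P})$ to $\mathcal G$. 2. For each supported alternative $\mathfrak Q$ to $\mathfrak P$, every $\widehat Q$, $Q\in\mathfrak Q$, is a probability measure, and $\widehat{\mathfrak Q}=\{\widehat Q\mid Q\in\mathfrak Q\}$ is a supported alternative to $\widehat{\mathfrak P}$. 3. One may assume $\mathcal G=\mathcal G(\widehat{\mathfrak Q})$. More precisely, in the situation of (2), $(\mathcal G(\widehat{\mathfrak Q}),\widehat{\mathfrak Q}^\sharp)$ is an enlargement of $(\mathcal G,\widehat{\mathfrak P})$ whose canonical map $L^\infty(\mathcal G,\widehat{\mathfrak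 P})\to L^\infty(\mathcal G(\widehat{\mathfrak Q}),\widehat{\mathfrak Q}^\sharp)$ is a lattice isomorphism (a bijective linear lattice homomorphism). Moreover, $(\mathcal G(\widehat{\mathfrak Q}),\widehat{\mathfrak Q}^\sharp)$ is an enlargement of $(\mathcal F,\mathfrak P)$ that completes $L^\infty(\mathcal F,\mathfrak P)$, the extension of $\mathfrak Q$ to $\mathcal G(\widehat{\mathfrak Q})$ in the sense of (2) is $\widehat{\mathfrak Q}^\sharp$, and the completion of $\mathcal G(\widehat{\mathfrak Q})$ along $\widehat{\mathfrak Q}^\sharp$ is $\mathcal G(\widehat{\mathfrak Q})$ itself. -/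

import Mathlib

open MeasureTheory Filter
open scoped ENNReal

namespace QuasiSure

/-! ### Vector lattices -/

section VectorLattice

variable {X Y : Type*} [AddCommGroup X] [Module ℝ X] [Lattice X]
  [AddCommGroup Y] [Module ℝ Y] [Lattice Y]

/-- Every nonempty set which is bounded above has a supremum. -/
def IsDedekindComplete (X : Type*) [Lattice X] : Prop :=
  ∀ s : Set X, s.Nonempty → BddAbove s → ∃ a, IsLUB s a

/-- The subspace `S` is order dense. -/
def IsOrderDense (S : Submodule ℝ X) : Prop :=
  ∀ x : X, 0 < x → ∃ y ∈ S, 0 < y ∧ y ≤ x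

/-- The subspace `S` is majorising. -/
def IsMajorising (S : Submodule ℝ X) : Prop :=
  ∀ x : X, ∃ y ∈ S, x ≤ y

/-- A linear map which is a lattice homomorphism. -/
def IsLatticeHomomorphism (J : X →ₗ[ℝ] Y) : Prop :=
  (∀ x y : X, J (x ⊔ y) = J x ⊔ J y) ∧ ∀ x y : X, J (x ⊓ y) = J x ⊓ J y

/-- A bijective lattice homomorphism. -/
def IsLatticeIsomorphism (J : X →ₗ[ℝ] Y) : Prop :=
  IsLatticeHomomorphism J ∧ Function.Bijective J

/-- `Y` is the Dedekind completion of `X` by means of the map `J`: `Y` is Dedekind complete,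
`J` is a strictly positive lattice homomorphism, and the range of `J` is order dense and
majorising. -/
structure IsDedekindCompletion (J : X →ₗ[ℝ] Y) : Prop where
  complete : IsDedekindComplete Y
  hom : IsLatticeHomomorphism J
  strictly_positive : ∀ x : X, J (x ⊔ -x) = 0 → x = 0
  order_dense : IsOrderDense (LinearMap.range J)
  majorising : IsMajorising (LinearMap.range J)

end VectorLattice

/-! ### Upper probabilities, domination and supports -/

section Measures

variable {Ω : Type*} {m : MeasurableSpace Ω}

/-- The upper probability `A ↦ sup_{P ∈ 𝔓} P A`. -/
noncomputable def upperProb (𝔓 : Set (Measure Ω)) (A : Set Ω) : ℝ≥0∞ := ⨆ P ∈ 𝔓, P A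

lemma upperProb_eq_zero {𝔓 : Set (Measure Ω)} {A : Set Ω} :
    upperProb 𝔓 A = 0 ↔ ∀ P ∈ 𝔓, P A = 0 := by
  simp [upperProb]

/-- `𝔗` dominates `𝔖`. -/
def DominatedBy (𝔖 𝔗 : Set (Measure Ω)) : Prop :=
  ∀ N : Set Ω, MeasurableSet N → upperProb 𝔗 N = 0 → upperProb 𝔖 N = 0

/-- `𝔖 ≈ 𝔗`: mutual domination. -/
def Equivalent (𝔖 𝔗 : Set (Measure Ω)) : Prop :=
  DominatedBy 𝔖 𝔗 ∧ DominatedBy 𝔗 𝔖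

/-- The measure `μ` has an order support `S` with respect to `𝔓`. -/
def IsSupported (𝔓 : Set (Measure Ω)) (μ : Measure Ω) : Prop :=
  ∃ S : Set Ω, MeasurableSet S ∧ μ Sᶜ = 0 ∧
    ∀ N : Set Ω, MeasurableSet N → μ (N ∩ S) = 0 → upperProb 𝔓 (N ∩ S) = 0

/-- The finite signed measures dominated by `𝔓`. -/
def ca (𝔓 : Set (Measure Ω)) : Set (SignedMeasure Ω) :=
  {μ | DominatedBy {μ.totalVariation} 𝔓}

/-- The supported signed measures: those `μ ∈ ca 𝔓` whose modulus is supported. -/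
def sca (𝔓 : Set (Measure Ω)) : Set (SignedMeasure Ω) :=
  {μ | μ ∈ ca 𝔓 ∧ IsSupported 𝔓 μ.totalVariation}

/-- `𝔔` is a supported alternative to `𝔓`: a nonempty set of probability measures which is
equivalent to `𝔓` and consists of supported measures. -/
structure IsSupportedAlternative (𝔓 𝔔 : Set (Measure Ω)) : Prop where
  nonempty : 𝔔.Nonempty
  prob : ∀ Q ∈ 𝔔, IsProbabilityMeasure Q
  equiv : Equivalent 𝔔 𝔓
  supported : ∀ Q ∈ 𝔔, IsSupported 𝔓 Q

/-- `𝔓` is of class (S). -/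
def IsClassS (𝔓 : Set (Measure Ω)) : Prop := ∃ 𝔔, IsSupportedAlternative 𝔓 𝔔

/-! ### The space of quasi-surely bounded random variables -/

/-- The filter of properties that hold quasi surely, i.e. outside a measurable set of upper
probability zero. -/
def qs (𝔓 : Set (Measure Ω)) : Filter Ω where
  sets := {s | ∃ N : Set Ω, MeasurableSet N ∧ upperProb 𝔓 N = 0 ∧ sᶜ ⊆ N}
  univ_sets := ⟨∅, MeasurableSet.empty, by simp [upperProb], by simp⟩
  sets_of_superset := by
    rintro s t ⟨N, hN, h0, hs⟩ hst
    exact ⟨N, hN, h0, (Set.compl_subset_compl.2 hst).trans hs⟩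
  inter_sets := by
    rintro s t ⟨N, hN, h0, hs⟩ ⟨M, hM, h1, ht⟩
    refine ⟨N ∪ M, hN.union hM, ?_, ?_⟩
    · rw [upperProb_eq_zero] at *
      intro P hP
      exact measure_union_null (h0 P hP) (h1 P hP)
    · rw [Set.compl_inter]
      exact Set.union_subset_union hs ht

/-- The space of quasi-surely bounded random variables modulo quasi-sure equality.
The class of a random variable `f : Ω → ℝ` is its germ along `qs 𝔓`; germs are equal (resp.
`≤`) if and only if the functions are quasi-surely equal (resp. `≤`), and the algebraic
operations are those of representatives. -/
def Linfty (𝔓 : Set (Measure Ω)) : Submodule ℝ (Germ (qs 𝔓) ℝ) where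
  carrier := {X | ∃ f : Ω → ℝ, Measurable f ∧ (∃ K : ℝ, 0 < K ∧ ∀ᶠ ω in qs 𝔓, |f ω| ≤ K) ∧
    X = (f : Germ (qs 𝔓) ℝ)}
  zero_mem' := ⟨fun _ => 0, measurable_const, ⟨1, one_pos, by simp⟩, rfl⟩
  add_mem' := by
    rintro _ _ ⟨f, hf, ⟨K, hK, hfK⟩, rfl⟩ ⟨g, hg, ⟨L, hL, hgL⟩, rfl⟩
    refine ⟨f + g, hf.add hg, ⟨K + L, by positivity, ?_⟩, rfl⟩
    filter_upwards [hfK, hgL] with ω h1 h2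
    exact (abs_add_le _ _).trans (add_le_add h1 h2)
  smul_mem' := by
    rintro c _ ⟨f, hf, ⟨K, hK, hfK⟩, rfl⟩
    refine ⟨c • f, hf.const_smul c, ⟨|c| * K + 1, by positivity, ?_⟩, rfl⟩
    filter_upwards [hfK] with ω h1
    have := mul_le_mul_of_nonneg_left h1 (abs_nonneg c)
    simp only [Pi.smul_apply, smul_eq_mul, abs_mul]
    linarith

lemma Linfty.sup_mem {𝔓 : Set (Measure Ω)} {X Y : Germ (qs 𝔓) ℝ} (hX : X ∈ Linfty 𝔓)
    (hY : Y ∈ Linfty 𝔓) : X ⊔ Y ∈ Linfty 𝔓 := by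
  obtain ⟨f, hf, ⟨K, hK, hfK⟩, rfl⟩ := hX
  obtain ⟨g, hg, ⟨L, hL, hgL⟩, rfl⟩ := hY
  refine ⟨f ⊔ g, hf.sup hg, ⟨max K L, lt_max_of_lt_left hK, ?_⟩, rfl⟩
  filter_upwards [hfK, hgL] with ω h1 h2
  exact abs_max_le_max_abs_abs.trans (max_le_max h1 h2)

lemma Linfty.inf_mem {𝔓 : Set (Measure Ω)} {X Y : Germ (qs 𝔓) ℝ} (hX : X ∈ Linfty 𝔓)
    (hY : Y ∈ Linfty 𝔓) : X ⊓ Y ∈ Linfty 𝔓 := by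
  obtain ⟨f, hf, ⟨K, hK, hfK⟩, rfl⟩ := hX
  obtain ⟨g, hg, ⟨L, hL, hgL⟩, rfl⟩ := hY
  refine ⟨f ⊓ g, hf.inf hg, ⟨max K L, lt_max_of_lt_left hK, ?_⟩, rfl⟩
  filter_upwards [hfK, hgL] with ω h1 h2
  exact abs_min_le_max_abs_abs.trans (max_le_max h1 h2)

/-- The quasi-sure order on `Linfty 𝔓` is a lattice order, with the pointwise maximum and
minimum of representatives. -/
noncomputable instance Linfty.instLattice (𝔓 : Set (Measure Ω)) : Lattice (Linfty 𝔓) :=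
  Subtype.lattice (fun _ _ hX hY => Linfty.sup_mem hX hY) (fun _ _ hX hY => Linfty.inf_mem hX hY)

/-! ### Completion of a σ-algebra along a set of measures -/

/-- The `μ`-negligible sets. -/
def negligible (μ : Measure Ω) : Set (Set Ω) :=
  {A | ∃ N : Set Ω, MeasurableSet N ∧ μ N = 0 ∧ A ⊆ N}

/-- The completion of the σ-algebra along `𝔖`: the intersection over `μ ∈ 𝔖` of the
σ-algebras generated by the measurable and the `μ`-negligible sets. -/
@[reducible] def completion (𝔖 : Set (Measure Ω)) : MeasurableSpace Ω :=
  ⨅ μ ∈ 𝔖, MeasurableSpace.generateFrom ({A | MeasurableSet A} ∪ negligible μ)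

lemma completion_le_caratheodory {𝔖 : Set (Measure Ω)} {μ : Measure Ω} (hμ : μ ∈ 𝔖) :
    completion 𝔖 ≤ μ.toOuterMeasure.caratheodory := by
  refine (iInf₂_le μ hμ).trans (MeasurableSpace.generateFrom_le ?_)
  rintro A (hA | ⟨N, hN, h0, hAN⟩)
  · exact le_toOuterMeasure_caratheodory μ A hA
  · have hA : μ A = 0 := measure_mono_null hAN h0
    refine (OuterMeasure.isCaratheodory_iff_le _).2 fun t => ?_
    have h1 : μ (t ∩ A) = 0 := measure_mono_null Set.inter_subset_right hA
    have h2 : μ (t \ A) ≤ μ t := measure_mono Set.sdiff_subset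
    simpa [h1] using h2

/-- The extension of `μ ∈ 𝔖` to the completion of the σ-algebra along `𝔖`, namely the
restriction of the outer measure of `μ` to that σ-algebra. -/
noncomputable def sharp {𝔖 : Set (Measure Ω)} {μ : Measure Ω} (hμ : μ ∈ 𝔖) :
    @Measure Ω (completion 𝔖) :=
  @OuterMeasure.toMeasure Ω (completion 𝔖) μ.toOuterMeasure (completion_le_caratheodory hμ)

/-- The set of the extensions of all `μ ∈ 𝔖` to the completion along `𝔖`. -/
noncomputable def sharpFamily (𝔖 : Set (Measure Ω)) : Set (@Measure Ω (completion 𝔖)) :=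
  Set.range fun μ : 𝔖 => sharp μ.2

end Measures

/-! ### Enlargements -/

section Enlargements

variable {Ω : Type*} {F G : MeasurableSpace Ω}

/-- `(G, 𝔓')` is an enlargement of `(F, 𝔓)`. -/
structure IsEnlargement (𝔓 : Set (@Measure Ω F)) (𝔓' : Set (@Measure Ω G)) : Prop where
  le : F ≤ G
  nonempty : 𝔓'.Nonempty
  prob : ∀ P ∈ 𝔓', IsProbabilityMeasure P
  equiv : Equivalent ((fun P : @Measure Ω G => P.trim le) '' 𝔓') 𝔓

lemma IsEnlargement.qs_le {𝔓 : Set (@Measure Ω F)} {𝔓' : Set (@Measure Ω G)}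
    (h : IsEnlargement 𝔓 𝔓') : qs 𝔓' ≤ qs 𝔓 := by
  rintro s ⟨N, hN, h0, hs⟩
  refine ⟨N, h.le N hN, ?_, hs⟩
  rw [upperProb_eq_zero]
  intro P hP
  have := upperProb_eq_zero.1 (h.equiv.1 N hN h0) _ (Set.mem_image_of_mem _ hP)
  rwa [trim_measurableSet_eq h.le hN] at this

/-- The canonical map `[f] ↦ ⟨f⟩` from `Linfty 𝔓` to `Linfty 𝔓'`, which sends the
`𝔓`-quasi-sure class of a random variable to its `𝔓'`-quasi-sure class. -/
def IsEnlargement.J {𝔓 : Set (@Measure Ω F)} {𝔓' : Set (@Measure Ω G)}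
    (h : IsEnlargement 𝔓 𝔓') : Linfty 𝔓 →ₗ[ℝ] Linfty 𝔓' where
  toFun X := ⟨X.1.compTendsto id h.qs_le, by
    obtain ⟨_, f, hf, ⟨K, hK, hfK⟩, rfl⟩ := X
    exact ⟨f, hf.mono h.le le_rfl, ⟨K, hK, h.qs_le hfK⟩, rfl⟩⟩
  map_add' := by
    rintro ⟨_, f, hf, hfK, rfl⟩ ⟨_, g, hg, hgK, rfl⟩
    rfl
  map_smul' := by
    rintro c ⟨_, f, hf, hfK, rfl⟩
    rfl

/-- The enlargement completes `Linfty 𝔓`: the canonical map exhibits `Linfty 𝔓'` as the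
Dedekind completion of `Linfty 𝔓`. -/
def IsEnlargement.Completes {𝔓 : Set (@Measure Ω F)} {𝔓' : Set (@Measure Ω G)}
    (h : IsEnlargement 𝔓 𝔓') : Prop :=
  IsDedekindCompletion h.J

/-- `ν` is a supported extension to `G` of the signed measure `μ` on `F`. -/
def IsSupportedExtension (hle : F ≤ G) (𝔓' : Set (@Measure Ω G)) (μ : @SignedMeasure Ω F)
    (ν : @SignedMeasure Ω G) : Prop :=
  ν ∈ sca 𝔓' ∧ ν.trim hle = μ

/-- The set of all probability measures on `G` that are supported extensions of some member
of `𝔔`. -/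
def extendFamily (hle : F ≤ G) (𝔓' : Set (@Measure Ω G)) (𝔔 : Set (@Measure Ω F)) :
    Set (@Measure Ω G) :=
  {R | ∃ Q ∈ 𝔔, ∃ (_ : IsProbabilityMeasure Q) (_ : IsProbabilityMeasure R),
    IsSupportedExtension hle 𝔓' Q.toSignedMeasure R.toSignedMeasure}

end Enlargements

end QuasiSure

open QuasiSure

/-! Order density of the range of `J`, tested on indicators, says that every non-polar event of `G`
contains, up to a polar set, a non-polar event of `F` (`HasDenseEvents`). Below the support of a
finite measure on `F`, null `F`-events are polar, so an exhaustion argument improves this: there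
every `G`-event is quasi surely equal to an `F`-event (`HasDenseEvents.exists_eventuallyEq`).

A supported signed measure therefore has no freedom on `G`. Its extension must give `A` the value `μ
B`, where `B` is an `F`-event quasi surely equal to `A ∩ S` and `S` is the support; this formula
also defines the extension. Its values are values of `μ`, so probabilities extend to probabilities,
and dense events carry the equivalence from `F` to `G`.

Completing along the extended alternative adds no new classes, because `Linfty 𝔓'` is Dedekind
complete. A function measurable for the completed σ-algebra has a measurable version on each
support, and a supremum glues these versions (`IsSupportedAlternative.surjective_J_sharpFamily`).
Dedekind completions are preserved by the resulting lattice isomorphism. -/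

namespace QuasiSure

/-! ### Domination and supports in terms of filters; total variation. -/

section QuasiSureFilter

variable {Ω : Type*} {m : MeasurableSpace Ω} {𝔓 𝔔 : Set (Measure Ω)} {μ : Measure Ω}

lemma mem_qs_iff {s : Set Ω} (hs : MeasurableSet s) : s ∈ qs 𝔓 ↔ ∀ P ∈ 𝔓, P sᶜ = 0 := by
  constructor
  · rintro ⟨N, -, h0, hN⟩ P hP
    exact measure_mono_null hN (upperProb_eq_zero.1 h0 P hP)
  · exact fun h => ⟨sᶜ, hs.compl, upperProb_eq_zero.2 h, subset_rfl⟩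

lemma exists_measurableSet_mem_qs {s : Set Ω} (hs : s ∈ qs 𝔓) :
    ∃ t ⊆ s, MeasurableSet t ∧ t ∈ qs 𝔓 := by
  obtain ⟨N, hN, h0, h⟩ := hs
  exact ⟨Nᶜ, Set.compl_subset_comm.1 h, hN.compl, ⟨N, hN, h0, by simp⟩⟩

instance countableInterFilter_qs (𝔓 : Set (Measure Ω)) : CountableInterFilter (qs 𝔓) where
  countable_sInter_mem S hS h := by
    choose! N hN h0 hsub using h
    refine ⟨⋃ s ∈ S, N s, .biUnion hS fun s hs => hN s hs, ?_, ?_⟩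
    · refine upperProb_eq_zero.2 fun P hP => (measure_biUnion_null_iff hS).2 fun s hs => ?_
      exact upperProb_eq_zero.1 (h0 s hs) P hP
    · rw [Set.compl_sInter, Set.sUnion_image]
      exact Set.iUnion₂_mono hsub

lemma dominatedBy_iff : DominatedBy 𝔔 𝔓 ↔ qs 𝔔 ≤ qs 𝔓 := by
  refine ⟨fun h s hs => ?_, fun h N hN h0 => ?_⟩
  · obtain ⟨N, hN, h0, hs⟩ := hs
    exact ⟨N, hN, h N hN h0, hs⟩
  · have : Nᶜ ∈ qs 𝔔 := h ⟨N, hN, h0, by simp⟩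
    rw [mem_qs_iff hN.compl, compl_compl] at this
    exact upperProb_eq_zero.2 this

lemma qs_singleton : qs {μ} = ae μ := by
  ext s
  refine ⟨fun h => ?_, fun h => ?_⟩
  · obtain ⟨t, hts, ht, h⟩ := exists_measurableSet_mem_qs h
    rw [mem_qs_iff ht] at h
    exact mem_of_superset (h μ rfl) hts
  · refine ⟨toMeasurable μ sᶜ, measurableSet_toMeasurable _ _, ?_, subset_toMeasurable _ _⟩
    rw [upperProb_eq_zero]
    rintro _ rfl
    rwa [measure_toMeasurable]

lemma dominatedBy_singleton_iff : DominatedBy {μ} 𝔓 ↔ ae μ ≤ qs 𝔓 := by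
  rw [dominatedBy_iff, qs_singleton]

lemma equivalent_iff : Equivalent 𝔔 𝔓 ↔ qs 𝔔 = qs 𝔓 := by
  rw [Equivalent, dominatedBy_iff, dominatedBy_iff, le_antisymm_iff]

lemma ae_le_qs (hμ : μ ∈ 𝔓) : ae μ ≤ qs 𝔓 := fun s hs => by
  obtain ⟨t, hts, ht, h⟩ := exists_measurableSet_mem_qs hs
  exact mem_of_superset ((mem_qs_iff ht).1 h μ hμ) hts

/-- On the support, almost sure properties become quasi sure ones. Measurable hulls of null sets
allow arbitrary sets `t` here. -/
lemma isSupported_iff : IsSupported 𝔓 μ ↔ ∃ S : Set Ω, MeasurableSet S ∧ S ∈ ae μ ∧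
    ∀ t ∈ ae μ, ∀ᶠ ω in qs 𝔓, ω ∈ S → ω ∈ t := by
  refine exists_congr fun S => and_congr_right fun hS => and_congr Iff.rfl ?_
  refine ⟨fun h t ht => ?_, fun h N hN h0 => ?_⟩
  · have h1 := h (toMeasurable μ tᶜ) (measurableSet_toMeasurable _ _)
      (measure_mono_null Set.inter_subset_left (by rw [measure_toMeasurable]; exact ht))
    refine ⟨_, (measurableSet_toMeasurable μ tᶜ).inter hS, h1, fun ω hω => ?_⟩
    simp only [Set.mem_compl_iff, Set.mem_ofPred_eq, Classical.not_imp] at hω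
    exact ⟨subset_toMeasurable _ _ hω.2, hω.1⟩
  · have h1 := h (N ∩ S)ᶜ (by rwa [mem_ae_iff, compl_compl])
    have h2 : (N ∩ S)ᶜ ∈ qs 𝔓 := by
      filter_upwards [h1] with ω hω h
      exact hω h.2 h
    rw [mem_qs_iff (hN.inter hS).compl, compl_compl] at h2
    exact upperProb_eq_zero.2 h2

/-- By the Hahn decomposition, each Jordan part of `A` is up to sign the value of `ν` on a
measurable subset of `A`. -/
lemma totalVariation_eq_zero_iff (ν : SignedMeasure Ω) {A : Set Ω} (hA : MeasurableSet A) :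
    ν.totalVariation A = 0 ↔ ∀ B ⊆ A, MeasurableSet B → ν B = 0 := by
  refine ⟨fun h B hB _ => ν.null_of_totalVariation_zero (measure_mono_null hB h), fun h => ?_⟩
  obtain ⟨i, hi, hp, hn, h1, h2⟩ := ν.toJordanDecomposition_spec
  rw [SignedMeasure.totalVariation, Measure.add_apply, h1, h2,
    SignedMeasure.toMeasureOfZeroLE_apply _ _ _ hA, SignedMeasure.toMeasureOfLEZero_apply _ _ _ hA]
  have e1 := h (i ∩ A) Set.inter_subset_right (hi.inter hA)
  have e2 := h (iᶜ ∩ A) Set.inter_subset_right (hi.compl.inter hA)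
  simp only [e1, e2]
  simp

lemma measure_congr_totalVariation (ν : SignedMeasure Ω) {A B : Set Ω} (hA : MeasurableSet A)
    (hB : MeasurableSet B) (h : A =ᵐ[ν.totalVariation] B) : ν A = ν B := by
  have h1 : ν (A \ B) = 0 := ν.null_of_totalVariation_zero (ae_le_set.1 h.le)
  have h2 : ν (B \ A) = 0 := ν.null_of_totalVariation_zero (ae_le_set.1 h.symm.le)
  simpa [h1] using (VectorMeasure.of_sdiff_of_sdiff_eq_zero hA hB h2).symm

lemma totalVariation_toSignedMeasure (μ : Measure Ω) [IsFiniteMeasure μ] :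
    μ.toSignedMeasure.totalVariation = μ := by
  have : μ.toSignedMeasure.toJordanDecomposition =
      ⟨μ, 0, Measure.MutuallySingular.zero_right⟩ := by
    apply SignedMeasure.toJordanDecomposition_eq
    simp [JordanDecomposition.toSignedMeasure]
  simp [SignedMeasure.totalVariation, this]

instance isFiniteMeasure_totalVariation (ν : SignedMeasure Ω) :
    IsFiniteMeasure ν.totalVariation := by
  unfold SignedMeasure.totalVariation; infer_instance

end QuasiSureFilter

/-! ### Bounded representatives of quasi-sure classes. -/

section LinftyRepresentatives

variable {Ω : Type*} {m : MeasurableSpace Ω} {𝔓 : Set (Measure Ω)}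

/-- The class of a bounded random variable. -/
def Linfty.mk (f : Ω → ℝ) (hf : Measurable f) (hb : ∃ K : ℝ, ∀ ω, |f ω| ≤ K) : Linfty 𝔓 :=
  ⟨(f : Germ (qs 𝔓) ℝ), f, hf, hb.imp' (fun K => |K| + 1) fun K h =>
    ⟨by positivity, .of_forall fun ω => (h ω).trans ((le_abs_self K).trans (by simp))⟩, rfl⟩

lemma Linfty.mk_le_mk {f g : Ω → ℝ} {hf : Measurable f} {hg : Measurable g}
    {hbf : ∃ K : ℝ, ∀ ω, |f ω| ≤ K} {hbg : ∃ K : ℝ, ∀ ω, |g ω| ≤ K} :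
    (Linfty.mk f hf hbf : Linfty 𝔓) ≤ Linfty.mk g hg hbg ↔ f ≤ᶠ[qs 𝔓] g :=
  Germ.coe_le

lemma Linfty.mk_eq_mk {f g : Ω → ℝ} {hf : Measurable f} {hg : Measurable g}
    {hbf : ∃ K : ℝ, ∀ ω, |f ω| ≤ K} {hbg : ∃ K : ℝ, ∀ ω, |g ω| ≤ K} :
    (Linfty.mk f hf hbf : Linfty 𝔓) = Linfty.mk g hg hbg ↔ f =ᶠ[qs 𝔓] g :=
  Subtype.ext_iff.trans Germ.coe_eq

lemma Linfty.exists_mk_eq (X : Linfty 𝔓) : ∃ f hf hb, X = Linfty.mk f hf hb := by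
  obtain ⟨_, f, hf, ⟨K, hK, hfK⟩, rfl⟩ := X
  -- Truncating at the quasi-sure bound changes `f` only on a polar set.
  refine ⟨fun ω => max (-K) (min (f ω) K), by fun_prop, ⟨K, fun ω => ?_⟩, ?_⟩
  · exact abs_le.2 ⟨le_max_left _ _, max_le (by linarith) (min_le_right _ _)⟩
  · refine Subtype.ext (Germ.coe_eq.2 ?_)
    filter_upwards [hfK] with ω h
    rw [min_eq_left (abs_le.1 h).2, max_eq_right (abs_le.1 h).1]

end LinftyRepresentatives

/-! ### Dense events; uniqueness and existence of supported extensions. -/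

section Enlargement

variable {Ω : Type*} {F G : MeasurableSpace Ω} {𝔓 : Set (@Measure Ω F)} {𝔓' : Set (@Measure Ω G)}

lemma IsEnlargement.mem_qs_iff (h : IsEnlargement 𝔓 𝔓') {s : Set Ω} (hs : MeasurableSet[F] s) :
    s ∈ qs 𝔓' ↔ s ∈ qs 𝔓 := by
  rw [← equivalent_iff.1 h.equiv, QuasiSure.mem_qs_iff hs, QuasiSure.mem_qs_iff (h.le s hs),
    Set.forall_mem_image]
  refine forall₂_congr fun P _ => ?_
  rw [trim_measurableSet_eq h.le hs.compl]

lemma IsEnlargement.J_mk (h : IsEnlargement 𝔓 𝔓') {f : Ω → ℝ} (hf : Measurable[F] f)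
    (hb : ∃ K : ℝ, ∀ ω, |f ω| ≤ K) :
    h.J (Linfty.mk f hf hb) = Linfty.mk f (hf.mono h.le le_rfl) hb := rfl

lemma IsEnlargement.isLatticeHomomorphism_J (h : IsEnlargement 𝔓 𝔓') :
    IsLatticeHomomorphism h.J := by
  refine ⟨?_, ?_⟩ <;>
  · rintro ⟨_, f, hf, hfK, rfl⟩ ⟨_, g, hg, hgK, rfl⟩
    rfl

lemma IsEnlargement.injective_J (h : IsEnlargement 𝔓 𝔓') : Function.Injective h.J := by
  intro X Y hXY
  obtain ⟨f, hf, hbf, rfl⟩ := Linfty.exists_mk_eq X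
  obtain ⟨g, hg, hbg, rfl⟩ := Linfty.exists_mk_eq Y
  rw [h.J_mk, h.J_mk, Linfty.mk_eq_mk] at hXY
  exact Linfty.mk_eq_mk.2 ((h.mem_qs_iff (measurableSet_eq_fun hf hg)).1 hXY)

/-- Every event in `G` which is not polar contains, quasi surely, an event in `F` which is not
polar. -/
def HasDenseEvents (F : MeasurableSpace Ω) (𝔓' : Set (@Measure Ω G)) : Prop :=
  ∀ A : Set Ω, MeasurableSet[G] A → Aᶜ ∉ qs 𝔓' →
    ∃ B : Set Ω, MeasurableSet[F] B ∧ Bᶜ ∉ qs 𝔓' ∧ B ≤ᶠ[qs 𝔓'] A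

/-- If `0 < f ≤ 1_A` in the quasi-sure order with `f` measurable for `F`, then `{f > 0}` is
non-polar and quasi surely inside `A`. -/
lemma IsEnlargement.hasDenseEvents (h : IsEnlargement 𝔓 𝔓')
    (hd : IsOrderDense (LinearMap.range h.J)) : HasDenseEvents F 𝔓' := by
  intro A hA hpolar
  have hm : Measurable[G] (A.indicator (1 : Ω → ℝ)) := measurable_one.indicator hA
  have hb : ∃ K : ℝ, ∀ ω, |A.indicator (1 : Ω → ℝ) ω| ≤ K :=
    ⟨1, fun ω => by by_cases hω : ω ∈ A <;> simp [hω]⟩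
  have h0 : (Linfty.mk (fun _ => 0) (@measurable_const _ _ _ G 0) ⟨0, by simp⟩ : Linfty 𝔓') = 0 :=
    rfl
  obtain ⟨_, ⟨X, rfl⟩, hpos, hle⟩ := hd (Linfty.mk (A.indicator 1) hm hb) (by
    rw [← h0, lt_iff_le_not_ge, Linfty.mk_le_mk, Linfty.mk_le_mk]
    refine ⟨.of_forall fun ω => Set.indicator_nonneg (by simp) ω, fun hle => hpolar ?_⟩
    filter_upwards [hle] with ω hω hωA
    norm_num [hωA] at hω)
  obtain ⟨f, hf, hbf, rfl⟩ := Linfty.exists_mk_eq X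
  rw [h.J_mk, ← h0, lt_iff_le_not_ge, Linfty.mk_le_mk, Linfty.mk_le_mk] at hpos
  rw [h.J_mk, Linfty.mk_le_mk] at hle
  refine ⟨{ω | 0 < f ω}, measurableSet_lt measurable_const hf, fun hmem => hpos.2 ?_, ?_⟩
  · filter_upwards [hmem] with ω hω
    simpa using hω
  · filter_upwards [hle] with ω hω hfω
    by_contra hωA
    have h1 : 0 < f ω := hfω
    have h2 : ω ∉ A := hωA
    simp only [h2, not_false_eq_true, Set.indicator_of_notMem] at hω
    linarith

/-- On a set where quasi-sure nullity of `F`-events is implied by nullity for a finite measure,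
events in `G` are quasi surely equal to events in `F`. -/
lemma HasDenseEvents.exists_eventuallyEq (hd : HasDenseEvents F 𝔓') (hle : F ≤ G)
    (μ : @Measure Ω F) [@IsFiniteMeasure Ω F μ] {T A : Set Ω}
    (hT : ∀ B, MeasurableSet[F] B → B ≤ᶠ[qs 𝔓'] T → μ B = 0 → Bᶜ ∈ qs 𝔓')
    (hA : MeasurableSet[G] A) (hAT : A ≤ᶠ[qs 𝔓'] T) :
    ∃ B, MeasurableSet[F] B ∧ B =ᶠ[qs 𝔓'] A := by
  let C : Set (Set Ω) := {B | MeasurableSet[F] B ∧ B ≤ᶠ[qs 𝔓'] A}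
  have hC : (μ '' C).Nonempty :=
    ⟨_, Set.mem_image_of_mem _ ⟨(@MeasurableSet.empty Ω F), .of_forall fun ω h => h.elim⟩⟩
  -- The union of a maximising sequence in `C` attains the supremum of `μ` over `C`.
  obtain ⟨u, -, hu, huC⟩ := exists_seq_tendsto_sSup hC (OrderTop.bddAbove _)
  choose B hBC hBu using huC
  have hm : MeasurableSet[F] (⋃ n, B n) := .iUnion fun n => (hBC n).1
  have hsub : (⋃ n, B n) ≤ᶠ[qs 𝔓'] A := by
    filter_upwards [eventually_countable_forall.2 fun n => (hBC n).2] with ω h hω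
    obtain ⟨n, hn⟩ := Set.mem_iUnion.1 hω
    exact h n hn
  have hmax : ∀ D ∈ C, μ D ≤ μ (⋃ n, B n) := fun D hD =>
    (le_sSup (Set.mem_image_of_mem _ hD)).trans
      (le_of_tendsto' hu fun n => hBu n ▸ measure_mono (Set.subset_iUnion B n))
  refine ⟨⋃ n, B n, hm, hsub.antisymm ?_⟩
  -- A non-polar remainder would contain a non-polar `F`-event. By maximality that event adds no
  -- `μ`-mass, hence by `hT` it adds only a polar set.
  have key : (A \ ⋃ n, B n)ᶜ ∈ qs 𝔓' := by
    by_contra hpolar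
    obtain ⟨D, hD, hDp, hDA⟩ := hd _ (hA.diff (hle _ hm)) hpolar
    have hDm : MeasurableSet[F] (D \ ⋃ n, B n) := hD.diff hm
    have hDC : (⋃ n, B n) ∪ (D \ ⋃ n, B n) ∈ C := by
      refine ⟨hm.union hDm, ?_⟩
      filter_upwards [hsub, hDA] with ω h1 h2 hω
      exact hω.elim h1 fun h => (h2 h.1).1
    have h1 := hmax _ hDC
    rw [measure_union Set.disjoint_sdiff_right hDm] at h1
    have h0 : μ (D \ ⋃ n, B n) = 0 := by
      by_contra hne
      exact absurd h1 (not_le.2 (ENNReal.lt_add_right (measure_ne_top _ _) hne))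
    have h2 := hT _ hDm (by
      filter_upwards [hDA, hAT] with ω h3 h4 hω
      exact h4 (h3 hω.1).1) h0
    refine hDp ?_
    filter_upwards [h2, hDA] with ω h3 h4 hω
    exact h3 ⟨hω, (h4 hω).2⟩
  filter_upwards [key] with ω h hω
  by_contra hn
  exact h ⟨hω, hn⟩

/-- Both extensions live on the union of their supports, where every `G`-event is quasi surely an
`F`-event, and on `F` both equal `μ`. -/
lemma IsEnlargement.supportedExtension_unique (h : IsEnlargement 𝔓 𝔓')
    (hd : HasDenseEvents F 𝔓') {μ : @SignedMeasure Ω F} {ν₁ ν₂ : @SignedMeasure Ω G}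
    (h₁ : IsSupportedExtension h.le 𝔓' μ ν₁) (h₂ : IsSupportedExtension h.le 𝔓' μ ν₂) :
    ν₁ = ν₂ := by
  obtain ⟨⟨hc₁, hs₁⟩, ht₁⟩ := h₁
  obtain ⟨⟨hc₂, hs₂⟩, ht₂⟩ := h₂
  obtain ⟨S₁, hS₁, hm₁, hz₁⟩ := isSupported_iff.1 hs₁
  obtain ⟨S₂, hS₂, hm₂, hz₂⟩ := isSupported_iff.1 hs₂
  replace hc₁ := dominatedBy_singleton_iff.1 hc₁
  replace hc₂ := dominatedBy_singleton_iff.1 hc₂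
  have key : ∀ A, MeasurableSet[G] A → A ⊆ S₁ ∪ S₂ → ν₁ A = ν₂ A := by
    intro A hA hAS
    -- The sum of the two variations makes null `F`-events below `S₁ ∪ S₂` polar.
    obtain ⟨B, hB, hBA⟩ := hd.exists_eventuallyEq h.le
      ((ν₁.totalVariation + ν₂.totalVariation).trim h.le) (T := S₁ ∪ S₂) (A := A) (by
        intro B hB hBT h0
        rw [trim_measurableSet_eq h.le hB, Measure.add_apply, add_eq_zero] at h0
        filter_upwards [hBT, hz₁ Bᶜ (by rw [mem_ae_iff, compl_compl]; exact h0.1),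
          hz₂ Bᶜ (by rw [mem_ae_iff, compl_compl]; exact h0.2)] with ω h1 h2 h3 hω
        exact (h1 hω).elim (fun h => h2 h hω) (fun h => h3 h hω)) hA (.of_forall hAS)
    rw [← measure_congr_totalVariation ν₁ (h.le _ hB) hA (hc₁ hBA),
      ← measure_congr_totalVariation ν₂ (h.le _ hB) hA (hc₂ hBA),
      ← VectorMeasure.trim_measurableSet_eq h.le hB, ← VectorMeasure.trim_measurableSet_eq h.le hB,
      ht₁, ht₂]
  ext A hA
  have hAS : MeasurableSet[G] (A ∩ (S₁ ∪ S₂)) := hA.inter (hS₁.union hS₂)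
  rw [← measure_congr_totalVariation ν₁ hAS hA, ← measure_congr_totalVariation ν₂ hAS hA,
    key _ hAS Set.inter_subset_right]
  · filter_upwards [hm₂] with ω hω
    exact propext ⟨fun h => h.1, fun h => ⟨h, .inr hω⟩⟩
  · filter_upwards [hm₁] with ω hω
    exact propext ⟨fun h => h.1, fun h => ⟨h, .inl hω⟩⟩

/-- The extension is `A ↦ μ B` with `B` quasi surely equal to `A ∩ S`. The final clause later yields
positivity when `μ` is a measure. -/
lemma IsEnlargement.exists_supportedExtension (h : IsEnlargement 𝔓 𝔓')
    (hd : HasDenseEvents F 𝔓') {μ : @SignedMeasure Ω F} (hμ : μ ∈ sca 𝔓) :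
    ∃ ν : @SignedMeasure Ω G, IsSupportedExtension h.le 𝔓' μ ν ∧
      ∀ A, MeasurableSet[G] A → ∃ B, MeasurableSet[F] B ∧ ν A = μ B := by
  classical
  obtain ⟨hc, hs⟩ := hμ
  obtain ⟨S, hS, hmS, hz⟩ := isSupported_iff.1 hs
  replace hc := dominatedBy_singleton_iff.1 hc
  have hex : ∀ A, ∃ B, MeasurableSet[F] B ∧ (MeasurableSet[G] A → B =ᶠ[qs 𝔓'] (A ∩ S : Set Ω)) := by
    intro A
    by_cases hA : MeasurableSet[G] A
    · obtain ⟨B, hB, hBA⟩ := hd.exists_eventuallyEq h.le (@SignedMeasure.totalVariation Ω F μ)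
          (T := S) (A := A ∩ S) (by
        intro B hB hBT h0
        filter_upwards [hBT, h.qs_le (hz Bᶜ (by rwa [mem_ae_iff, compl_compl]))] with ω h1 h2 hω
        exact h2 (h1 hω) hω) (hA.inter (h.le _ hS)) (.of_forall Set.inter_subset_right)
      exact ⟨B, hB, fun _ => hBA⟩
    · exact ⟨∅, @MeasurableSet.empty Ω F, fun h => absurd h hA⟩
  choose B hB hBA using hex
  have hempty : μ ∅ = 0 := @VectorMeasure.empty' Ω F ℝ _ _ μ
  have hcongr : ∀ {C D : Set Ω}, MeasurableSet[F] C → MeasurableSet[F] D → C =ᶠ[qs 𝔓'] D →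
      μ C = μ D := by
    intro C D hC hD hCD
    refine measure_congr_totalVariation μ hC hD (hc ?_)
    -- Quasi-sure statements descend from `𝔓'` to `𝔓` only through sets measurable for `F`.
    have hset : MeasurableSet[F] {ω | C ω = D ω} := by
      have : {ω | C ω = D ω} = (symmDiff C D)ᶜ := by
        ext ω
        simp only [Set.mem_compl_iff, Set.mem_symmDiff, Set.mem_ofPred_eq, eq_iff_iff]
        change (ω ∈ C ↔ ω ∈ D) ↔ _
        tauto
      rw [this]
      exact (hC.symmDiff hD).compl
    exact (h.mem_qs_iff hset).1 hCD
  let ν : @SignedMeasure Ω G := @VectorMeasure.mk Ω G ℝ _ _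
    (fun A => if MeasurableSet[G] A then μ (B A) else 0)
    (by
      rw [if_pos MeasurableSet.empty, ← hempty]
      exact hcongr (hB _) (@MeasurableSet.empty Ω F)
        ((hBA ∅ MeasurableSet.empty).trans (by rw [Set.empty_inter]; rfl)))
    (fun A hA => if_neg hA)
    (fun A hA hdisj => by
      simp only [hA, if_true, MeasurableSet.iUnion hA]
      have hall : ∀ᶠ ω in qs 𝔓', ∀ n, ω ∈ B (A n) ↔ ω ∈ A n ∩ S :=
        eventually_countable_forall.2 fun n => (hBA _ (hA n)).mem_iff
      -- The sets `B (A n)` are disjoint only quasi surely, so they are made disjoint at the cost of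
      -- polar sets.
      have h1 : ∀ n, μ (B (A n)) = μ (disjointed (fun n => B (A n)) n) := by
        intro n
        refine hcongr (hB _) (MeasurableSet.disjointed (fun n => hB _) n) ?_
        filter_upwards [hall] with ω hω
        refine propext ⟨fun hn => ?_, fun hn => disjointed_subset (fun n => B (A n)) n hn⟩
        change ω ∈ disjointed (fun n => B (A n)) n
        rw [disjointed_eq_inter_compl]
        refine ⟨hn, Set.mem_iInter₂.2 fun k hk hkω => ?_⟩
        exact Set.disjoint_left.1 (hdisj hk.ne) ((hω k).1 hkω).1 ((hω n).1 hn).1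
      have h2 : μ (B (⋃ n, A n)) = μ (⋃ n, disjointed (fun n => B (A n)) n) := by
        rw [iUnion_disjointed]
        refine hcongr (hB _) (.iUnion fun n => hB _) ?_
        filter_upwards [hall, (hBA _ (.iUnion hA)).mem_iff] with ω hω hω'
        refine propext (hω'.trans ?_)
        change _ ↔ ω ∈ ⋃ n, B (A n)
        simp only [Set.mem_iUnion, Set.mem_inter_iff, hω]
        tauto
      simp only [h1, h2]
      exact μ.m_iUnion (MeasurableSet.disjointed (fun n => hB _)) (disjoint_disjointed _))
  have hν : ∀ {A C}, MeasurableSet[G] A → MeasurableSet[F] C → C =ᶠ[qs 𝔓'] (A ∩ S : Set Ω) →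
      ν A = μ C := fun {A C} hA hC hCA =>
    (if_pos hA).trans (hcongr (hB _) hC ((hBA A hA).trans hCA.symm))
  refine ⟨ν, ⟨⟨?_, ?_⟩, ?_⟩, fun A hA => ⟨B A, hB A, if_pos hA⟩⟩
  · intro N hN h0
    rw [upperProb_eq_zero] at h0 ⊢
    rintro _ rfl
    refine (totalVariation_eq_zero_iff ν hN).2 fun A hAN hA => ?_
    rw [hν hA (@MeasurableSet.empty Ω F) ?_, hempty]
    have : Nᶜ ∈ qs 𝔓' := (QuasiSure.mem_qs_iff hN.compl).2 (by rwa [compl_compl])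
    filter_upwards [this] with ω hω
    exact propext ⟨fun h => h.elim, fun h => hω (hAN h.1)⟩
  · refine ⟨S, h.le _ hS, ?_, fun N hN h0 => ?_⟩
    · refine (totalVariation_eq_zero_iff ν (h.le _ hS).compl).2 fun A hAN hA => ?_
      rw [hν hA (@MeasurableSet.empty Ω F) ?_, hempty]
      exact .of_forall fun ω => propext ⟨fun h => h.elim, fun h => hAN h.1 h.2⟩
    · have hNS := hN.inter (h.le _ hS)
      have hBN := (hBA _ hNS).mem_iff
      have hB0 : @SignedMeasure.totalVariation Ω F μ (B (N ∩ S)) = 0 := by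
        refine (totalVariation_eq_zero_iff μ (hB _)).2 fun C hC hCm => ?_
        -- For `C ⊆ B (N ∩ S)`, the event `C ∩ (N ∩ S)` is quasi surely `C`, so `ν` gives it the
        -- value `μ C`.
        have h1 := (totalVariation_eq_zero_iff ν hNS).1 h0 (C ∩ (N ∩ S)) Set.inter_subset_right
          ((h.le _ hCm).inter hNS)
        rwa [hν ((h.le _ hCm).inter hNS) hCm ?_] at h1
        filter_upwards [hBN] with ω hω
        exact propext ⟨fun hω' => ⟨⟨hω', (hω.1 (hC hω')).1⟩, (hω.1 (hC hω')).2⟩,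
          fun hω' => hω'.1.1⟩
      have h2 := h.qs_le (hz (B (N ∩ S))ᶜ (by rwa [mem_ae_iff, compl_compl]))
      have h3 : (N ∩ S)ᶜ ∈ qs 𝔓' := by
        filter_upwards [h2, hBN] with ω h4 h5 h6
        exact h4 h6.2 (h5.2 ⟨h6, h6.2⟩)
      rw [QuasiSure.mem_qs_iff hNS.compl, compl_compl] at h3
      exact upperProb_eq_zero.2 h3
  · ext A hA
    rw [VectorMeasure.trim_measurableSet_eq h.le hA, hν (h.le _ hA) (hA.inter hS) .rfl]
    refine measure_congr_totalVariation μ (hA.inter hS) hA ?_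
    filter_upwards [hmS] with ω hω
    exact propext ⟨fun h => h.1, fun h => ⟨h, hω⟩⟩

end Enlargement

/-! ### Dedekind completions under lattice isomorphisms. -/

section LatticeTransport

variable {X Y Z : Type*} [AddCommGroup X] [Module ℝ X] [Lattice X]
  [AddCommGroup Y] [Module ℝ Y] [Lattice Y] [AddCommGroup Z] [Module ℝ Z] [Lattice Z]

lemma IsLatticeIsomorphism.le_iff_le {I : Y →ₗ[ℝ] Z} (hI : IsLatticeIsomorphism I) {x y : Y} :
    I x ≤ I y ↔ x ≤ y := by
  rw [← inf_eq_left, ← hI.1.2, hI.2.1.eq_iff, inf_eq_left]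

lemma IsDedekindCompletion.comp_isLatticeIsomorphism {J : X →ₗ[ℝ] Y} {I : Y →ₗ[ℝ] Z}
    (hJ : IsDedekindCompletion J) (hI : IsLatticeIsomorphism I) :
    IsDedekindCompletion (I ∘ₗ J) where
  complete := by
    intro s hs hb
    let e : Y ≃o Z := ⟨Equiv.ofBijective I hI.2, hI.le_iff_le⟩
    obtain ⟨a, ha⟩ := hJ.complete (e ⁻¹' s) (hs.preimage e.surjective) (by
      obtain ⟨b, hb⟩ := hb
      exact ⟨e.symm b, fun y hy => (e.le_symm_apply).2 (hb hy)⟩)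
    refine ⟨e a, fun z hz => ?_, fun b hb => ?_⟩
    · rw [← e.symm_apply_le]
      exact ha.1 (by simpa using hz)
    · rw [← e.le_symm_apply]
      exact ha.2 fun y hy => (e.le_symm_apply).2 (hb hy)
  hom := ⟨fun x y => by simp [hJ.hom.1, hI.1.1], fun x y => by simp [hJ.hom.2, hI.1.2]⟩
  strictly_positive x hx := hJ.strictly_positive x (hI.2.1 (by simpa using hx))
  order_dense := by
    intro z hz
    obtain ⟨y, rfl⟩ := hI.2.2 z
    have hlt : ∀ {y : Y}, 0 < I y ↔ 0 < y := fun {y} => by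
      rw [lt_iff_le_not_ge, lt_iff_le_not_ge, ← hI.le_iff_le, ← hI.le_iff_le, map_zero]
    obtain ⟨_, ⟨x, rfl⟩, hpos, hle⟩ := hJ.order_dense y (hlt.1 hz)
    exact ⟨_, ⟨x, rfl⟩, hlt.2 hpos, hI.le_iff_le.2 hle⟩
  majorising := by
    intro z
    obtain ⟨y, rfl⟩ := hI.2.2 z
    obtain ⟨_, ⟨x, rfl⟩, hle⟩ := hJ.majorising y
    exact ⟨_, ⟨x, rfl⟩, hI.le_iff_le.2 hle⟩

end LatticeTransport

/-! ### Composition of enlargements. -/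

section EnlargementTransport

variable {Ω : Type*} {F G H : MeasurableSpace Ω} {𝔓 : Set (@Measure Ω F)}
  {𝔓' : Set (@Measure Ω G)} {𝔓'' : Set (@Measure Ω H)}

lemma IsEnlargement.of_mem_qs_iff (hle : F ≤ G) (hne : 𝔓'.Nonempty)
    (hprob : ∀ P ∈ 𝔓', IsProbabilityMeasure P)
    (hqs : ∀ s, MeasurableSet[F] s → (s ∈ qs 𝔓' ↔ s ∈ qs 𝔓)) : IsEnlargement 𝔓 𝔓' := by
  refine ⟨hle, hne, hprob, ?_⟩
  have key : ∀ N, MeasurableSet[F] N →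
      (upperProb ((fun P : @Measure Ω G => P.trim hle) '' 𝔓') N = 0 ↔ upperProb 𝔓 N = 0) := by
    intro N hN
    have h := hqs Nᶜ hN.compl
    rw [QuasiSure.mem_qs_iff hN.compl, QuasiSure.mem_qs_iff (hle _ hN.compl), compl_compl] at h
    rw [upperProb_eq_zero, upperProb_eq_zero, ← h, Set.forall_mem_image]
    refine forall₂_congr fun P _ => ?_
    rw [trim_measurableSet_eq hle hN]
  exact ⟨fun N hN => (key N hN).2, fun N hN => (key N hN).1⟩

lemma IsEnlargement.trans (h : IsEnlargement 𝔓 𝔓') (h' : IsEnlargement 𝔓' 𝔓'') :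
    IsEnlargement 𝔓 𝔓'' :=
  .of_mem_qs_iff (h.le.trans h'.le) h'.nonempty h'.prob fun s hs =>
    (h'.mem_qs_iff (h.le s hs)).trans (h.mem_qs_iff hs)

lemma IsEnlargement.Completes.trans {h : IsEnlargement 𝔓 𝔓'} (hC : h.Completes)
    (h' : IsEnlargement 𝔓' 𝔓'') (hI : IsLatticeIsomorphism h'.J) : (h.trans h').Completes := by
  have : (h.trans h').J = h'.J ∘ₗ h.J := by
    refine LinearMap.ext ?_
    rintro ⟨_, f, hf, hfK, rfl⟩
    rfl
  rw [Completes, this]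
  exact IsDedekindCompletion.comp_isLatticeIsomorphism hC hI

end EnlargementTransport

/-! ### Completion along a supported alternative. -/

section Completion

variable {Ω : Type*} {m : MeasurableSpace Ω} {𝔓 𝔔 : Set (Measure Ω)} {μ : Measure Ω}

lemma le_completion (𝔔 : Set (Measure Ω)) : m ≤ completion 𝔔 :=
  le_iInf₂ fun _ _ _ hs => MeasurableSpace.measurableSet_generateFrom (.inl hs)

lemma nullMeasurableSet_of_completion (hμ : μ ∈ 𝔔) {s : Set Ω}
    (hs : MeasurableSet[completion 𝔔] s) : NullMeasurableSet s μ := by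
  have h1 : completion 𝔔 ≤ (NullMeasurableSpace.instMeasurableSpace : MeasurableSpace
      (NullMeasurableSpace Ω μ)) := by
    refine (iInf₂_le μ hμ).trans (MeasurableSpace.generateFrom_le ?_)
    rintro A (hA | ⟨N, -, h0, hAN⟩)
    · exact MeasurableSet.nullMeasurableSet hA
    · exact NullMeasurableSet.of_null (measure_mono_null hAN h0)
  exact h1 s hs

lemma sharp_apply (hμ : μ ∈ 𝔔) {s : Set Ω} (hs : MeasurableSet[completion 𝔔] s) :
    sharp hμ s = μ s :=
  @toMeasure_apply Ω (completion 𝔔) _ (completion_le_caratheodory hμ) s hs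

lemma ae_sharp (hμ : μ ∈ 𝔔) : ae (sharp hμ) = ae μ := by
  ext s
  rw [mem_ae_iff, mem_ae_iff]
  refine ⟨fun h => ?_, fun h => ?_⟩
  · rw [← @measure_toMeasurable Ω (completion 𝔔) (sharp hμ),
      sharp_apply hμ (@measurableSet_toMeasurable _ (completion 𝔔) _ _)] at h
    exact measure_mono_null (@subset_toMeasurable _ (completion 𝔔) _ _) h
  · refine measure_mono_null (subset_toMeasurable μ _) ?_
    rw [sharp_apply hμ (le_completion 𝔔 _ (measurableSet_toMeasurable _ _)), measure_toMeasurable, h]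

lemma isProbabilityMeasure_sharp (hμ : μ ∈ 𝔔) [IsProbabilityMeasure μ] :
    IsProbabilityMeasure (sharp hμ) :=
  ⟨by rw [sharp_apply hμ MeasurableSet.univ, measure_univ]⟩

lemma mem_qs_sharpFamily_iff {s : Set Ω} (hs : MeasurableSet[completion 𝔔] s) :
    s ∈ qs (sharpFamily 𝔔) ↔ ∀ Q ∈ 𝔔, s ∈ ae Q := by
  rw [mem_qs_iff hs, sharpFamily, Set.forall_mem_range, Subtype.forall]
  refine forall₂_congr fun Q hQ => ?_
  rw [← mem_ae_iff, ae_sharp hQ]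

lemma qs_sharpFamily_le : qs (sharpFamily 𝔔) ≤ qs 𝔔 := fun s hs => by
  obtain ⟨t, hts, ht, h⟩ := exists_measurableSet_mem_qs hs
  exact mem_of_superset ((mem_qs_sharpFamily_iff (le_completion 𝔔 t ht)).2
    ((mem_qs_iff ht).1 h)) hts

lemma IsSupportedAlternative.isEnlargement_sharpFamily (h : IsSupportedAlternative 𝔓 𝔔) :
    IsEnlargement 𝔓 (sharpFamily 𝔔) := by
  refine .of_mem_qs_iff (le_completion 𝔔) ?_ ?_ fun s hs => ?_
  · obtain ⟨Q, hQ⟩ := h.nonempty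
    exact ⟨_, ⟨Q, hQ⟩, rfl⟩
  · rintro _ ⟨⟨Q, hQ⟩, rfl⟩
    have := h.prob Q hQ
    exact isProbabilityMeasure_sharp hQ
  · rw [mem_qs_sharpFamily_iff (le_completion 𝔔 s hs), ← equivalent_iff.1 h.equiv, mem_qs_iff hs]
    rfl

lemma isSupported_sharp (h : IsSupportedAlternative 𝔓 𝔔) (hμ : μ ∈ 𝔔) :
    IsSupported (sharpFamily 𝔔) (sharp hμ) := by
  obtain ⟨S, hS, hmS, hz⟩ := isSupported_iff.1 (h.supported μ hμ)
  refine isSupported_iff.2 ⟨S, le_completion 𝔔 S hS, by rwa [ae_sharp], fun t ht => ?_⟩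
  rw [ae_sharp] at ht
  exact qs_sharpFamily_le (equivalent_iff.1 h.equiv ▸ hz t ht)

/-- A `sharp hQ`-null set is already `Q`-null, so completing again adds no negligible sets. -/
lemma completion_sharpFamily (𝔔 : Set (Measure Ω)) :
    completion (sharpFamily 𝔔) = completion 𝔔 := by
  refine le_antisymm (le_iInf₂ fun Q hQ => ?_) (le_completion (sharpFamily 𝔔))
  refine (iInf₂_le (sharp hQ) ⟨⟨Q, hQ⟩, rfl⟩).trans (MeasurableSpace.generateFrom_le ?_)
  rintro A (hA | ⟨N, -, h0, hAN⟩)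
  · exact iInf₂_le (f := fun (μ : Measure Ω) (_ : μ ∈ 𝔔) =>
      MeasurableSpace.generateFrom ({A | MeasurableSet A} ∪ negligible μ)) Q hQ A hA
  · refine MeasurableSpace.measurableSet_generateFrom (.inr ⟨toMeasurable Q N,
      measurableSet_toMeasurable _ _, ?_, hAN.trans (subset_toMeasurable _ _)⟩)
    have : Nᶜ ∈ ae (sharp hQ) := by rwa [mem_ae_iff, compl_compl]
    rwa [ae_sharp, mem_ae_iff, compl_compl, ← measure_toMeasurable] at this

/-- On the support of each `Q`, `f` agrees quasi surely with a measurable `g Q`. These local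
versions, possibly uncountably many, are glued by a supremum in `Linfty 𝔓`. -/
lemma IsSupportedAlternative.surjective_J_sharpFamily (h : IsSupportedAlternative 𝔓 𝔔)
    (hc : IsDedekindComplete (Linfty 𝔓)) :
    Function.Surjective h.isEnlargement_sharpFamily.J := by
  classical
  intro X
  obtain ⟨f, hf, ⟨K, hK⟩, rfl⟩ := Linfty.exists_mk_eq X
  have hex : ∀ Q : 𝔔, ∃ g : Ω → ℝ, Measurable g ∧ (∀ ω, -K ≤ g ω ∧ g ω ≤ K) ∧
      ∃ S, MeasurableSet S ∧ S ∈ ae Q.1 ∧ ∀ᶠ ω in qs 𝔓, ω ∈ S → f ω = g ω := by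
    rintro ⟨Q, hQ⟩
    have hae : AEMeasurable f Q :=
      NullMeasurable.aemeasurable fun s hs => nullMeasurableSet_of_completion hQ (hf hs)
    obtain ⟨S, hS, hmS, hz⟩ := isSupported_iff.1 (h.supported Q hQ)
    refine ⟨fun ω => max (-K) (min (hae.mk f ω) K), ?_, fun ω => ⟨le_max_left _ _, ?_⟩,
      S, hS, hmS, hz _ ?_⟩
    · have := hae.measurable_mk
      fun_prop
    · exact max_le (by linarith [(abs_nonneg _).trans (hK ω)]) (min_le_right _ _)
    · filter_upwards [hae.ae_eq_mk] with ω hω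
      change f ω = _
      rw [← hω, min_eq_left (abs_le.1 (hK ω)).2, max_eq_right (abs_le.1 (hK ω)).1]
  choose g hg hgK S hS hmS hfg using hex
  have hpm : ∀ (Q : 𝔔) (c : ℝ), Measurable ((S Q).piecewise (g Q) fun _ => c) :=
    fun Q c => (hg Q).piecewise (hS Q) measurable_const
  have hpb : ∀ (Q : 𝔔) (c : ℝ), |c| ≤ |K| → ∀ ω, |(S Q).piecewise (g Q) (fun _ => c) ω| ≤ |K| := by
    intro Q c hcK ω
    by_cases hω : ω ∈ S Q
    · simpa [hω] using (abs_le.2 (hgK Q ω)).trans (le_abs_self K)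
    · simpa [hω] using hcK
  -- Off the support, `L Q` and `U Q` take the extreme values `-K` and `K`, so they leave the
  -- supremum unconstrained there.
  let L : 𝔔 → Linfty 𝔓 := fun Q => Linfty.mk _ (hpm Q (-K)) ⟨_, hpb Q (-K) (by simp)⟩
  let U : 𝔔 → Linfty 𝔓 := fun Q => Linfty.mk _ (hpm Q K) ⟨_, hpb Q K le_rfl⟩
  -- On overlapping supports both versions agree with `f`; elsewhere the bounds `±K` decide.
  have hLU : ∀ Q, U Q ∈ upperBounds (Set.range L) := by
    rintro Q _ ⟨R, rfl⟩
    refine Linfty.mk_le_mk.2 ?_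
    filter_upwards [hfg Q, hfg R] with ω h1 h2
    by_cases hR : ω ∈ S R <;> by_cases hQ : ω ∈ S Q
    · simp [hR, hQ, ← h1 hQ, ← h2 hR]
    · simpa [hR, hQ] using (hgK R ω).2
    · simpa [hR, hQ] using (hgK Q ω).1
    · simpa [hR, hQ] using (hgK R ω).1.trans (hgK R ω).2
  have : Nonempty 𝔔 := h.nonempty.to_subtype
  obtain ⟨Y, hY⟩ := hc (Set.range L) (Set.range_nonempty L) ⟨_, hLU (Classical.arbitrary 𝔔)⟩
  obtain ⟨k, hk, hbk, rfl⟩ := Linfty.exists_mk_eq Y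
  refine ⟨Linfty.mk k hk hbk, ?_⟩
  rw [IsEnlargement.J_mk, Linfty.mk_eq_mk]
  have hset : MeasurableSet[completion 𝔔] {ω | k ω = f ω} :=
    measurableSet_eq_fun (hk.mono (le_completion 𝔔) le_rfl) hf
  refine (mem_qs_sharpFamily_iff hset).2 fun Q hQ => ?_
  have hle : ae Q ≤ qs 𝔓 := equivalent_iff.1 h.equiv ▸ ae_le_qs hQ
  -- The supremum lies between `L Q` and `U Q`, which coincide on the support of `Q`.
  have h1 := hY.1 ⟨⟨Q, hQ⟩, rfl⟩
  have h2 := hY.2 (hLU ⟨Q, hQ⟩)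
  filter_upwards [hmS ⟨Q, hQ⟩, hle (hfg ⟨Q, hQ⟩), hle (Linfty.mk_le_mk.1 h1),
    hle (Linfty.mk_le_mk.1 h2)] with ω h3 h4 h5 h6
  simp only [h3, Set.piecewise_eq_of_mem] at h5 h6
  rw [h4 h3]
  exact le_antisymm h6 h5

lemma IsSupportedAlternative.isLatticeIsomorphism_J_sharpFamily
    (h : IsSupportedAlternative 𝔓 𝔔) (hc : IsDedekindComplete (Linfty 𝔓)) :
    IsLatticeIsomorphism h.isEnlargement_sharpFamily.J :=
  ⟨h.isEnlargement_sharpFamily.isLatticeHomomorphism_J,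
    h.isEnlargement_sharpFamily.injective_J, h.surjective_J_sharpFamily hc⟩

end Completion

/-! ### Extending a supported alternative. -/

section ExtendedAlternative

variable {Ω : Type*} {F G : MeasurableSpace Ω} {𝔓 𝔔 : Set (@Measure Ω F)}
  {𝔓' : Set (@Measure Ω G)}

lemma toSignedMeasure_mem_sca_iff {m : MeasurableSpace Ω} {𝔖 : Set (Measure Ω)} {μ : Measure Ω}
    [IsFiniteMeasure μ] :
    μ.toSignedMeasure ∈ sca 𝔖 ↔ DominatedBy {μ} 𝔖 ∧ IsSupported 𝔖 μ := by
  simp only [sca, ca, Set.mem_ofPred_eq, totalVariation_toSignedMeasure]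

lemma toSignedMeasure_trim_eq_iff (hle : F ≤ G) {R : @Measure Ω G} {Q : @Measure Ω F}
    [IsFiniteMeasure R] [hQ : @IsFiniteMeasure Ω F Q] :
    R.toSignedMeasure.trim hle = @Measure.toSignedMeasure Ω F Q hQ ↔ R.trim hle = Q := by
  have hval : ∀ s, MeasurableSet[F] s → R.toSignedMeasure.trim hle s = (R s).toReal := by
    intro s hs
    rw [VectorMeasure.trim_measurableSet_eq hle hs,
      Measure.toSignedMeasure_apply_measurable (hle s hs), measureReal_def]
  have hval' : ∀ s, MeasurableSet[F] s →
      @Measure.toSignedMeasure Ω F Q hQ s = (Q s).toReal := fun s hs => if_pos hs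
  refine ⟨fun h => ?_, fun h => ?_⟩
  · refine @Measure.ext Ω F _ _ fun s hs => ?_
    rw [trim_measurableSet_eq hle hs, ← ENNReal.toReal_eq_toReal_iff' (measure_ne_top R s)
      (@measure_ne_top Ω F Q hQ s), ← hval s hs, h, hval' s hs]
  · refine @VectorMeasure.ext Ω F ℝ _ _ _ _ fun s hs => ?_
    rw [hval s hs, hval' s hs, ← h, trim_measurableSet_eq hle hs]

lemma mem_extendFamily_iff (hle : F ≤ G) (hprob : ∀ Q ∈ 𝔔, IsProbabilityMeasure Q)
    {R : @Measure Ω G} : R ∈ extendFamily hle 𝔓' 𝔔 ↔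
      IsProbabilityMeasure R ∧ DominatedBy {R} 𝔓' ∧ IsSupported 𝔓' R ∧ R.trim hle ∈ 𝔔 := by
  constructor
  · rintro ⟨Q, hQ, hQp, hRp, hsca, ht⟩
    obtain ⟨h1, h2⟩ := toSignedMeasure_mem_sca_iff.1 hsca
    exact ⟨hRp, h1, h2, by rwa [(toSignedMeasure_trim_eq_iff hle).1 ht]⟩
  · rintro ⟨hRp, h1, h2, hQ⟩
    have hQp := hprob _ hQ
    exact ⟨_, hQ, hQp, hRp, toSignedMeasure_mem_sca_iff.2 ⟨h1, h2⟩,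
      (toSignedMeasure_trim_eq_iff hle).2 rfl⟩

lemma IsEnlargement.measure_supportedExtension_unique (h : IsEnlargement 𝔓 𝔓')
    (hd : HasDenseEvents F 𝔓') {R R' : @Measure Ω G} [IsFiniteMeasure R] [IsFiniteMeasure R']
    (hR : DominatedBy {R} 𝔓') (hRs : IsSupported 𝔓' R)
    (hR' : DominatedBy {R'} 𝔓') (hRs' : IsSupported 𝔓' R')
    (heq : R.trim h.le = R'.trim h.le) : R = R' := by
  have : @IsFiniteMeasure Ω F (R'.trim h.le) := isFiniteMeasure_trim h.le
  exact Measure.toSignedMeasure_eq_toSignedMeasure_iff.1 (h.supportedExtension_unique hd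
    ⟨toSignedMeasure_mem_sca_iff.2 ⟨hR, hRs⟩, (toSignedMeasure_trim_eq_iff h.le).2 heq⟩
    ⟨toSignedMeasure_mem_sca_iff.2 ⟨hR', hRs'⟩, (toSignedMeasure_trim_eq_iff h.le).2 rfl⟩)

lemma IsEnlargement.exists_mem_extendFamily (h : IsEnlargement 𝔓 𝔓')
    (hd : HasDenseEvents F 𝔓') (h𝔔 : IsSupportedAlternative 𝔓 𝔔) {Q : @Measure Ω F}
    (hQ : Q ∈ 𝔔) : ∃ R ∈ extendFamily h.le 𝔓' 𝔔, R.trim h.le = Q := by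
  have hQp := h𝔔.prob Q hQ
  have hdom : DominatedBy {Q} 𝔓 :=
    dominatedBy_singleton_iff.2 (equivalent_iff.1 h𝔔.equiv ▸ ae_le_qs hQ)
  obtain ⟨ν, ⟨hsca, ht⟩, hval⟩ := h.exists_supportedExtension hd
    (toSignedMeasure_mem_sca_iff.2 ⟨hdom, h𝔔.supported Q hQ⟩)
  have hν : VectorMeasure.restrict 0 Set.univ ≤ ν.restrict Set.univ := by
    rw [VectorMeasure.restrict_le_restrict_iff _ _ MeasurableSet.univ]
    intro A hA _
    obtain ⟨B, hB, hAB⟩ := hval A hA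
    rw [hAB, zero_apply, Measure.toSignedMeasure_apply_measurable hB]
    exact ENNReal.toReal_nonneg
  obtain ⟨R, hR, hRν⟩ : ∃ (R : @Measure Ω G) (hR : IsFiniteMeasure R), R.toSignedMeasure = ν :=
    ⟨ν.toMeasureOfZeroLE Set.univ MeasurableSet.univ hν, inferInstance,
      SignedMeasure.toMeasureOfZeroLE_toSignedMeasure ν hν⟩
  subst hRν
  rw [toSignedMeasure_trim_eq_iff] at ht
  obtain ⟨h1, h2⟩ := toSignedMeasure_mem_sca_iff.1 hsca
  refine ⟨R, (mem_extendFamily_iff h.le h𝔔.prob).2 ⟨⟨?_⟩, h1, h2, ht ▸ hQ⟩, ht⟩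
  rw [← trim_measurableSet_eq h.le MeasurableSet.univ, ht, measure_univ]

lemma IsEnlargement.isSupportedAlternative_extendFamily (h : IsEnlargement 𝔓 𝔓')
    (hd : HasDenseEvents F 𝔓') (h𝔔 : IsSupportedAlternative 𝔓 𝔔) :
    IsSupportedAlternative 𝔓' (extendFamily h.le 𝔓' 𝔔) := by
  have hmem : ∀ R ∈ extendFamily h.le 𝔓' 𝔔, _ := fun R hR =>
    (mem_extendFamily_iff h.le h𝔔.prob).1 hR
  refine ⟨?_, fun R hR => (hmem R hR).1, ⟨?_, ?_⟩, fun R hR => (hmem R hR).2.2.1⟩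
  · obtain ⟨Q, hQ⟩ := h𝔔.nonempty
    obtain ⟨R, hR, -⟩ := h.exists_mem_extendFamily hd h𝔔 hQ
    exact ⟨R, hR⟩
  · intro N hN h0
    exact upperProb_eq_zero.2 fun R hR =>
      upperProb_eq_zero.1 ((hmem R hR).2.1 N hN h0) R rfl
  · intro N hN h0
    -- Otherwise `N` contains a non-polar `F`-event, yet every member of `𝔔` vanishes on it since
    -- its extension vanishes on `N`.
    have key : Nᶜ ∈ qs 𝔓' := by
      by_contra hpolar
      obtain ⟨B, hB, hBp, hBN⟩ := hd N hN hpolar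
      refine hBp ((h.mem_qs_iff hB.compl).2 ?_)
      rw [← equivalent_iff.1 h𝔔.equiv, QuasiSure.mem_qs_iff hB.compl, compl_compl]
      intro Q hQ
      obtain ⟨R, hR, rfl⟩ := h.exists_mem_extendFamily hd h𝔔 hQ
      rw [trim_measurableSet_eq h.le hB]
      exact measure_mono_null_ae (dominatedBy_singleton_iff.1 (hmem R hR).2.1 hBN)
        (upperProb_eq_zero.1 h0 R hR)
    rw [QuasiSure.mem_qs_iff hN.compl, compl_compl] at key
    exact upperProb_eq_zero.2 key

/-- Each `sharp hR` is a supported extension of the restriction of `R` to `F`, and uniqueness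
excludes any other. -/
lemma IsEnlargement.extendFamily_sharpFamily (h : IsEnlargement 𝔓 𝔓')
    (hd : HasDenseEvents F 𝔓') (h𝔔 : IsSupportedAlternative 𝔓 𝔔)
    (h' : IsEnlargement 𝔓 (sharpFamily (extendFamily h.le 𝔓' 𝔔)))
    (hd' : HasDenseEvents F (sharpFamily (extendFamily h.le 𝔓' 𝔔))) :
    extendFamily h'.le (sharpFamily (extendFamily h.le 𝔓' 𝔔)) 𝔔 =
      sharpFamily (extendFamily h.le 𝔓' 𝔔) := by
  have hsa := h.isSupportedAlternative_extendFamily hd h𝔔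
  have htrim : ∀ {R} (hR : R ∈ extendFamily h.le 𝔓' 𝔔),
      (sharp hR).trim h'.le = R.trim h.le := by
    intro R hR
    refine @Measure.ext Ω F _ _ fun s hs => ?_
    rw [trim_measurableSet_eq _ hs, trim_measurableSet_eq _ hs, sharp_apply hR (h'.le s hs)]
  have hdom : ∀ {R} (hR : R ∈ extendFamily h.le 𝔓' 𝔔),
      DominatedBy {sharp hR} (sharpFamily (extendFamily h.le 𝔓' 𝔔)) := fun {R} hR =>
    dominatedBy_singleton_iff.2 (ae_le_qs ⟨⟨R, hR⟩, rfl⟩)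
  have hp : ∀ {R} (hR : R ∈ extendFamily h.le 𝔓' 𝔔), IsProbabilityMeasure (sharp hR) :=
    fun {R} hR => by
      have := hsa.prob R hR
      exact isProbabilityMeasure_sharp hR
  ext W
  rw [mem_extendFamily_iff h'.le h𝔔.prob]
  constructor
  · rintro ⟨hWp, hWd, hWs, hWt⟩
    obtain ⟨R, hR, hRW⟩ := h.exists_mem_extendFamily hd h𝔔 hWt
    have := hp hR
    refine ⟨⟨R, hR⟩, h'.measure_supportedExtension_unique hd' (hdom hR) (isSupported_sharp hsa hR)
      hWd hWs ((htrim hR).trans hRW)⟩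
  · rintro ⟨⟨R, hR⟩, rfl⟩
    refine ⟨hp hR, hdom hR, isSupported_sharp hsa hR, ?_⟩
    rw [htrim hR]
    exact ((mem_extendFamily_iff h.le h𝔔.prob).1 hR).2.2.2

end ExtendedAlternative

end QuasiSure

theorem theoremC6 {Ω : Type*} {F G : MeasurableSpace Ω}
    (𝔓 : Set (@Measure Ω F)) (𝔓' : Set (@Measure Ω G))
    (hne : 𝔓.Nonempty) (hprob : ∀ P ∈ 𝔓, IsProbabilityMeasure P)
    (hS : IsClassS 𝔓)
    (hE : IsEnlargement 𝔓 𝔓') (hC : hE.Completes) :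
    -- every supported signed measure extends uniquely to a supported one
    (∀ μ ∈ sca 𝔓, ∃! ν : @SignedMeasure Ω G, IsSupportedExtension hE.le 𝔓' μ ν) ∧
    ∀ 𝔔 : Set (@Measure Ω F), IsSupportedAlternative 𝔓 𝔔 →
      -- the extension of each member of the supported alternative is a probability measure
      (∀ Q ∈ 𝔔, ∃ R ∈ extendFamily hE.le 𝔓' 𝔔, R.trim hE.le = Q) ∧
      -- these extensions form a supported alternative
      IsSupportedAlternative 𝔓' (extendFamily hE.le 𝔓' 𝔔) ∧
      -- completing `G` along them gives an enlargement of `(G, 𝔓')` whose canonical map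
      -- is a lattice isomorphism
      (∃ h : IsEnlargement 𝔓' (sharpFamily (extendFamily hE.le 𝔓' 𝔔)),
        IsLatticeIsomorphism h.J) ∧
      -- the completed σ-algebra may take the place of `G`: it again yields a completing
      -- enlargement of `(F, 𝔓)`, to which `𝔔` extends as the completed family, and it is
      -- complete along that family
      (∃ h : IsEnlargement 𝔓 (sharpFamily (extendFamily hE.le 𝔓' 𝔔)),
        h.Completes ∧
        extendFamily h.le (sharpFamily (extendFamily hE.le 𝔓' 𝔔)) 𝔔 =
          sharpFamily (extendFamily hE.le 𝔓' 𝔔) ∧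
        completion (sharpFamily (extendFamily hE.le 𝔓' 𝔔)) =
          completion (extendFamily hE.le 𝔓' 𝔔)) := by
  have hd := hE.hasDenseEvents hC.order_dense
  refine ⟨fun μ hμ => ?_, fun 𝔔 h𝔔 => ?_⟩
  · obtain ⟨ν, hν, -⟩ := hE.exists_supportedExtension hd hμ
    exact ⟨ν, hν, fun ν' hν' => hE.supportedExtension_unique hd hν' hν⟩
  · have hsa := hE.isSupportedAlternative_extendFamily hd h𝔔
    -- The gluing argument is applied over `G`, where Dedekind completeness is available.
    have hiso := hsa.isLatticeIsomorphism_J_sharpFamily hC.complete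
    let h' := hE.trans hsa.isEnlargement_sharpFamily
    have hC' : h'.Completes := IsEnlargement.Completes.trans hC hsa.isEnlargement_sharpFamily hiso
    exact ⟨fun Q hQ => hE.exists_mem_extendFamily hd h𝔔 hQ, hsa, ⟨_, hiso⟩, h', hC',
      hE.extendFamily_sharpFamily hd h𝔔 h' (h'.hasDenseEvents hC'.order_dense),
      completion_sharpFamily _⟩
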